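/- Let $K$ be a field, $R=K[x_1,\dots,x_n]$, and let $\Delta$ be a simplicial complex whose vertices are among $x_1,\dots,x_n$. Facets are maximal faces; a subcomplex of $\Delta$ is a simplicial complex whose facets are facets of $\Delta$. A facet $F$ is a *leaf* of a complex if it is the only facet or if there is a facet $G\ne F$ with $F\cap H\subseteq F\cap G$ for all facets $H\neq F$. A connected complex (any two facets are joined by a sequence of facets in which consecutive ones intersect) is a *tree* if each of its nonempty subcomplexes has a leaf, and a *forest* is a complex all of whose connected components are trees. Suppose that $\Delta$ is a forest which is pure of dimension $1$ (that is, $\Delta$ has at least one facet and all its facets are edges), and let $I\subset R$ be its facet ideal (edge ideal), generated by the monomials $x_ix_j$ with $\{x_i,x_j\}$ a facet of $\Delta$. Let $H_\bullet(R/I)=Z_\bullet/B_\bullet$ be the homology algebra of the Koszul complex of $R/I$ with respect to $x_1,\dots,x_n$, that is, of the exterior algebra over $R/I$ on $e_1,\dots,e_n$ with the differential given by $d(e_i)=x_i$. For $L=\{l_1<\dots<l_r\}\subseteq\{1,\dots,n\}$ put $e_L=e_{l_1}\wedge\dots\wedge e_{l_r}$. A *linear monomial cycle* is a cycle of the form $fe_L$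 with $f$ a monomial of degree $\delta-1$, where $\delta$ is the least degree of the minimal monomial generators of $I$; here $\delta=2$, so these are the cycles of the form $x_le_L$. Then $H_\bullet(R/I)$ is generated as a $K$-algebra by the homology classes of the linear monomial cycles. -/

import Mathlib

/-!
Simplicial complexes on a vertex type `V`: we use `PreAbstractSimplicialComplex V`, whose faces are
nonempty finite sets of vertices and whose vertex set may be smaller than `V`.  (The empty face is
not recorded; this does not change the facets of a complex having at least one vertex.)
-/

namespace PreAbstractSimplicialComplex

variable {V : Type*}

/-- The facets of `Δ`: the maximal faces. -/
def facets (Δ : PreAbstractSimplicialComplex V) : Set (Finset V) :=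
  {F | Maximal (fun G => G ∈ Δ.faces) F}

/-- `Δ` has dimension `d`: the largest number of vertices of a face is `d + 1`. -/
def HasDimension (Δ : PreAbstractSimplicialComplex V) (d : ℕ) : Prop :=
  IsGreatest (Finset.card '' Δ.faces) (d + 1)

/-- `Δ` is pure: all facets have the same dimension. -/
def IsPure (Δ : PreAbstractSimplicialComplex V) : Prop :=
  ∀ F ∈ Δ.facets, ∀ G ∈ Δ.facets, F.card = G.card

/-- `Γ` is a subcomplex of `Δ`, in the sense that the facets of `Γ` are facets of `Δ`. -/
def IsSubcomplex (Γ Δ : PreAbstractSimplicialComplex V) : Prop :=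
  Γ.facets ⊆ Δ.facets

/-- `Δ` is connected: any two facets are joined by a chain of facets
in which consecutive facets intersect. -/
def IsConnected [DecidableEq V] (Δ : PreAbstractSimplicialComplex V) : Prop :=
  ∀ F ∈ Δ.facets, ∀ G ∈ Δ.facets,
    Relation.ReflTransGen
      (fun A B => A ∈ Δ.facets ∧ B ∈ Δ.facets ∧ (A ∩ B).Nonempty) F G

/-- The facet `F` is a leaf of `Δ`: either it is the only facet, or there is a facet `G ≠ F` with
`F ∩ H ⊆ F ∩ G` for all facets `H ≠ F`. -/
def IsLeaf [DecidableEq V] (Δ : PreAbstractSimplicialComplex V) (F : Finset V) : Prop :=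
  F ∈ Δ.facets ∧
    (Δ.facets = {F} ∨
      ∃ G ∈ Δ.facets, G ≠ F ∧ ∀ H ∈ Δ.facets, H ≠ F → F ∩ H ⊆ F ∩ G)

/-- A tree (Faridi): a connected complex all of whose nonempty subcomplexes have a leaf. -/
def IsTree [DecidableEq V] (Δ : PreAbstractSimplicialComplex V) : Prop :=
  Δ.IsConnected ∧
    ∀ Γ : PreAbstractSimplicialComplex V, Γ.IsSubcomplex Δ → Γ.faces.Nonempty → ∃ F, Γ.IsLeaf F

/-- `Γ` is a connected component of `Δ`: a maximal nonempty connected subcomplex. -/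
def IsComponent [DecidableEq V] (Γ Δ : PreAbstractSimplicialComplex V) : Prop :=
  Maximal (fun Γ' : PreAbstractSimplicialComplex V =>
    Γ'.IsSubcomplex Δ ∧ Γ'.faces.Nonempty ∧ Γ'.IsConnected) Γ

/-- A forest: a complex all of whose connected components are trees. -/
def IsForest [DecidableEq V] (Δ : PreAbstractSimplicialComplex V) : Prop :=
  ∀ Γ : PreAbstractSimplicialComplex V, Γ.IsComponent Δ → Γ.IsTree

/-- The facet ideal of `Δ` in `K[x_v : v ∈ V]`, generated by the monomials `∏_{v ∈ F} x_v`
for the facets `F` of `Δ`. -/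
noncomputable def facetIdeal (K : Type*) [CommRing K] (Δ : PreAbstractSimplicialComplex V) :
    Ideal (MvPolynomial V K) :=
  Ideal.span {f | ∃ F ∈ Δ.facets, f = ∏ v ∈ F, MvPolynomial.X v}

end PreAbstractSimplicialComplex

namespace Koszul

noncomputable section

section General

variable {A : Type*} [CommRing A] {n : ℕ} (x : Fin n → A)

/-- The differential of the Koszul complex `⋀ (A ^ n)` of the sequence `x`: the antiderivation
of the exterior algebra that maps the basis vector `e i` to `x i`, so that
`d (e i * b) = x i • b - e i * d b`. -/
def d : ExteriorAlgebra A (Fin n → A) →ₗ[A] ExteriorAlgebra A (Fin n → A) :=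
  CliffordAlgebra.contractLeft (Fintype.linearCombination A x)

theorem d_d (a : ExteriorAlgebra A (Fin n → A)) : d x (d x a) = 0 :=
  CliffordAlgebra.contractLeft_contractLeft _ _

theorem d_one : d x 1 = 0 := CliffordAlgebra.contractLeft_one _ (d := Fintype.linearCombination A x)

theorem d_algebraMap (r : A) : d x (algebraMap A _ r) = 0 :=
  CliffordAlgebra.contractLeft_algebraMap _ (d := Fintype.linearCombination A x) r

theorem d_ι_mul (v : Fin n → A) (b : ExteriorAlgebra A (Fin n → A)) :
    d x (ExteriorAlgebra.ι A v * b) =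
      Fintype.linearCombination A x v • b - ExteriorAlgebra.ι A v * d x b :=
  CliffordAlgebra.contractLeft_ι_mul (d := Fintype.linearCombination A x) v b

/-- The Leibniz rule, with `involute a = (-1) ^ deg a • a` on homogeneous elements. -/
theorem d_mul (a b : ExteriorAlgebra A (Fin n → A)) :
    d x (a * b) = d x a * b + CliffordAlgebra.involute a * d x b := by
  induction a using CliffordAlgebra.left_induction generalizing b with
  | algebraMap r =>
    rw [d_algebraMap, zero_mul, zero_add, AlgHom.commutes, ← Algebra.smul_def,
      ← Algebra.smul_def, map_smul]
  | add a₁ a₂ h₁ h₂ => simp only [add_mul, map_add, h₁, h₂]; abel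
  | ι_mul a v h =>
    rw [mul_assoc, d_ι_mul, d_ι_mul, h, map_mul, CliffordAlgebra.involute_ι, sub_mul, mul_add,
      smul_mul_assoc, mul_assoc, neg_mul, neg_mul, mul_assoc]
    abel

theorem d_involute (a : ExteriorAlgebra A (Fin n → A)) :
    d x (CliffordAlgebra.involute a) = -CliffordAlgebra.involute (d x a) := by
  induction a using CliffordAlgebra.left_induction with
  | algebraMap r => rw [AlgHom.commutes, d_algebraMap, map_zero, neg_zero]
  | add a₁ a₂ h₁ h₂ => simp only [map_add, h₁, h₂]; abel
  | ι_mul a v h =>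
    rw [map_mul, CliffordAlgebra.involute_ι, neg_mul, map_neg, d_ι_mul, d_ι_mul, h, map_sub,
      map_smul, map_mul, CliffordAlgebra.involute_ι]
    simp

/-- The subalgebra of Koszul cycles. -/
def cycles : Subalgebra A (ExteriorAlgebra A (Fin n → A)) where
  carrier := {a | d x a = 0}
  mul_mem' := by
    intro a b ha hb
    change d x a = 0 at ha
    change d x b = 0 at hb
    change d x (a * b) = 0
    rw [d_mul, ha, hb, zero_mul, mul_zero, add_zero]
  add_mem' := by
    intro a b ha hb
    change d x a = 0 at ha
    change d x b = 0 at hb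
    change d x (a + b) = 0
    rw [map_add, ha, hb, add_zero]
  algebraMap_mem' := fun r => d_algebraMap x r

/-- The (two-sided) ideal of Koszul boundaries in the algebra of Koszul cycles. -/
def boundaries : Ideal (cycles x) where
  carrier := {z | ∃ w, d x w = z}
  add_mem' := by
    rintro a b ⟨w, hw⟩ ⟨w', hw'⟩
    exact ⟨w + w', by rw [map_add, hw, hw']; rfl⟩
  zero_mem' := ⟨0, map_zero _⟩
  smul_mem' := by
    rintro ⟨c, hc⟩ z ⟨w, hw⟩
    change d x c = 0 at hc
    refine ⟨CliffordAlgebra.involute c * w, ?_⟩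
    rw [d_mul, d_involute, hc, map_zero, neg_zero, zero_mul, zero_add,
      CliffordAlgebra.involute_involute, hw]
    rfl

instance : (boundaries x).IsTwoSided where
  mul_mem_of_left := by
    rintro z ⟨c, hc⟩ ⟨w, hw⟩
    change d x c = 0 at hc
    refine ⟨w * c, ?_⟩
    rw [d_mul, hc, mul_zero, add_zero, hw]
    rfl

/-- The Koszul homology algebra `H_•(x; A) = Z_• / B_•`. -/
abbrev Homology : Type _ := cycles x ⧸ boundaries x

end General

section Monomial

variable {K : Type*} [Field K] {n : ℕ} (I : Ideal (MvPolynomial (Fin n) K))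

/-- The residue classes of the variables in `R / I`, where `R = K[x_1, …, x_n]`.  The Koszul
complex of the `R`-module `R / I` with respect to `x_1, …, x_n` is the exterior algebra of
`(R / I) ^ n` with the differential `d (vars I)`. -/
def vars (i : Fin n) : MvPolynomial (Fin n) K ⧸ I :=
  Ideal.Quotient.mk I (MvPolynomial.X i)

/-- The basis element `e_L = e_{l_1} ∧ ⋯ ∧ e_{l_r}` for `L = {l_1 < ⋯ < l_r}`. -/
def wedge (A : Type*) [CommRing A] (L : Finset (Fin n)) : ExteriorAlgebra A (Fin n → A) :=
  ExteriorAlgebra.ιMulti A L.card (fun j => Pi.single (L.orderEmbOfFin rfl j) 1)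

/-- The exponents of the minimal monomial generators of a monomial ideal `I`: the monomials in `I`
that are minimal with respect to divisibility. -/
def minimalGenerators : Set (Fin n →₀ ℕ) :=
  {a | Minimal (fun b => MvPolynomial.monomial b (1 : K) ∈ I) a}

/-- The linear monomial cycles of the Koszul complex of `R / I`, for a monomial ideal `I`: cycles of
the form `f e_L` with `f` a monomial of degree `δ - 1`, where `δ` is the least degree of the
minimal monomial generators of `I`. -/
def linearMonomialCycles : Set (cycles (vars I)) :=
  {z | ∃ (a : Fin n →₀ ℕ) (L : Finset (Fin n)),
    IsLeast (Finsupp.degree '' minimalGenerators I) (a.degree + 1) ∧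
      (z : ExteriorAlgebra (MvPolynomial (Fin n) K ⧸ I) (Fin n → MvPolynomial (Fin n) K ⧸ I)) =
        Ideal.Quotient.mk I (MvPolynomial.monomial a 1) •
          wedge (MvPolynomial (Fin n) K ⧸ I) L}

end Monomial

end

end Koszul

/-! Lift cycles over R/I to chains over R, kept as finite sums of x^m ⊗ b with b in the exterior
algebra over K. Since I is a monomial ideal, `mem_null_of_realize_eq_zero` lets being a cycle be
tested coefficientwise: the differential of the lift must lie in `null`.

Give x_i and e_i degree 1 in the i-th variable. The homotopy e_i · (division by x_i) contracts
everything of positive i-degree over R. Restricted to i-degree at least 2 it preserves I, because I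
is squarefree (`up_down_down_mem_null`). Hence every cycle is, modulo boundaries, a sum of cycles of
squarefree degree S (`realize_mem`).

For such a cycle c, induct on S. A forest has a vertex v in S with at most one neighbour in S
(`IsForest.exists_vertex`). If v has none, the same homotopy shows that c is a boundary
(`sub_diff_htpy_mem_null`). If w is the only neighbour, then v is isolated in the support of the
e_w-part of c, so this part can be traded for a multiple of x_w and c becomes x_w a
(`exists_up_of_leaf`). As x_w x_u = 0 for each neighbour u of w, only terms of a with e_u survive,
so x_w a = x_w e_U · a' with U the set of neighbours of w in the support (`exists_realize_up_eq`).
The support of a' contains neither w nor its neighbours, so x_w can be cancelled and a' is a cycle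
of smaller support. The factor x_w e_U is a linear cycle. -/

namespace PreAbstractSimplicialComplex

/-! ### Forests and vertices with at most one neighbour -/

variable {V : Type*}

theorem mem_faces_of_mem_facets {Δ : PreAbstractSimplicialComplex V} {F : Finset V}
    (h : F ∈ Δ.facets) : F ∈ Δ.faces := h.prop

theorem exists_facet_superset [Finite V] (Δ : PreAbstractSimplicialComplex V) {F : Finset V}
    (h : F ∈ Δ.faces) : ∃ G ∈ Δ.facets, F ⊆ G := by
  obtain ⟨G, hFG, hG⟩ := (Set.toFinite Δ.faces).exists_le_maximal h
  exact ⟨G, hG, hFG⟩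

theorem IsSubcomplex.le [Finite V] {Γ Δ : PreAbstractSimplicialComplex V} (h : Γ.IsSubcomplex Δ) :
    Γ ≤ Δ := by
  intro F hF
  obtain ⟨G, hG, hFG⟩ := Γ.exists_facet_superset hF
  exact (Δ.isRelLowerSet_faces (mem_faces_of_mem_facets (h hG))).2 hFG
    (Γ.isRelLowerSet_faces hF).1

/-- The complex generated by a set of finite sets. -/
def generate (𝓕 : Set (Finset V)) : PreAbstractSimplicialComplex V where
  faces := {s | s.Nonempty ∧ ∃ F ∈ 𝓕, s ⊆ F}
  isRelLowerSet_faces := fun _ hs =>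
    ⟨hs.1, fun _ hts ht => ⟨ht, hs.2.imp fun _ hF => ⟨hF.1, hts.trans hF.2⟩⟩⟩

theorem facets_generate {Δ : PreAbstractSimplicialComplex V} {𝓕 : Set (Finset V)}
    (h : 𝓕 ⊆ Δ.facets) : (generate 𝓕).facets = 𝓕 := by
  have hface : ∀ F ∈ 𝓕, F ∈ (generate 𝓕).faces := fun F hF =>
    ⟨(Δ.isRelLowerSet_faces (mem_faces_of_mem_facets (h hF))).1, F, hF, subset_rfl⟩
  ext F
  constructor
  · intro hF
    obtain ⟨-, G, hG, hFG⟩ := hF.prop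
    rwa [hF.eq_of_le (hface G hG) hFG]
  · intro hF
    refine ⟨hface F hF, ?_⟩
    rintro s ⟨hs, G, hG, hsG⟩ hFs
    rw [(h hF).eq_of_le (mem_faces_of_mem_facets (h hG)) (hFs.trans hsG)]
    exact hsG

/-- A nonempty connected subcomplex of a forest has a leaf. -/
theorem IsForest.exists_isLeaf [Finite V] [DecidableEq V] {Δ Γ : PreAbstractSimplicialComplex V}
    (hΔ : Δ.IsForest) (h : Γ.IsSubcomplex Δ) (hne : Γ.faces.Nonempty) (hconn : Γ.IsConnected) :
    ∃ F, Γ.IsLeaf F := by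
  have : Finite (PreAbstractSimplicialComplex V) :=
    Finite.of_injective PreAbstractSimplicialComplex.faces
      fun _ _ => PreAbstractSimplicialComplex.ext
  obtain ⟨Γ', hle, hΓ'⟩ := Set.Finite.exists_le_maximal (Set.toFinite
    {Γ' : PreAbstractSimplicialComplex V |
      Γ'.IsSubcomplex Δ ∧ Γ'.faces.Nonempty ∧ Γ'.IsConnected}) ⟨h, hne, hconn⟩
  -- Facets of Γ are already maximal in Δ, hence also in the component Γ' lying between Γ and Δ.
  refine (hΔ Γ' hΓ').2 Γ (fun F hF => ⟨hle (mem_faces_of_mem_facets hF), fun G hG hFG => ?_⟩) hne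
  exact (h hF).le_of_ge (hΓ'.prop.1.le hG) hFG

/-- The graph formed by the edges among the facets. -/
def edgeGraph [DecidableEq V] (Δ : PreAbstractSimplicialComplex V) : SimpleGraph V where
  Adj i j := i ≠ j ∧ {i, j} ∈ Δ.facets
  symm := ⟨fun i j h => ⟨h.1.symm, Finset.pair_comm i j ▸ h.2⟩⟩
  loopless := ⟨fun _ h => h.1 rfl⟩

/-- The edges inside S reachable from a given one generate a connected subcomplex, which has a leaf.
One endpoint of this leaf lies on no other of these edges, and it serves as v. -/
theorem IsForest.exists_vertex [Finite V] [DecidableEq V] {Δ : PreAbstractSimplicialComplex V}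
    (hΔ : Δ.IsForest) (hcard : ∀ F ∈ Δ.facets, F.card = 2) {S : Finset V} (hS : S.Nonempty) :
    ∃ v ∈ S, ∀ a ∈ S, ∀ b ∈ S, Δ.edgeGraph.Adj v a → Δ.edgeGraph.Adj v b → a = b := by
  by_cases hF : ∃ F ∈ Δ.facets, F ⊆ S
  swap
  · obtain ⟨v, hv⟩ := hS
    exact ⟨v, hv, fun a ha _ _ hva => absurd
      ⟨_, hva.2, Finset.insert_subset hv (Finset.singleton_subset_iff.2 ha)⟩ hF⟩
  obtain ⟨F₀, hF₀, hF₀S⟩ := hF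
  let r : Finset V → Finset V → Prop := fun A B =>
    (A ∈ Δ.facets ∧ A ⊆ S) ∧ (B ∈ Δ.facets ∧ B ⊆ S) ∧ (A ∩ B).Nonempty
  let 𝓕 : Set (Finset V) := {F | Relation.ReflTransGen r F₀ F}
  have h𝓕 : ∀ F ∈ 𝓕, F ∈ Δ.facets ∧ F ⊆ S := by
    intro F hF
    induction hF with
    | refl => exact ⟨hF₀, hF₀S⟩
    | tail _ h _ => exact h.2.1
  have hfac : (generate 𝓕).facets = 𝓕 := facets_generate fun F hF => (h𝓕 F hF).1
  -- The joining chains must themselves stay in 𝓕 for the generated complex to be connected.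
  have hchain : ∀ F ∈ 𝓕, Relation.ReflTransGen (fun A B => A ∈ 𝓕 ∧ B ∈ 𝓕 ∧ (A ∩ B).Nonempty)
      F₀ F := by
    intro F hF
    induction hF with
    | refl => exact .refl
    | tail h h' ih => exact ih.tail ⟨h, h.tail h', h'.2.2⟩
  obtain ⟨F, hFleaf⟩ := hΔ.exists_isLeaf (Γ := generate 𝓕)
    (by rw [IsSubcomplex, hfac]; exact fun F hF => (h𝓕 F hF).1)
    ⟨F₀, mem_faces_of_mem_facets (hfac.symm ▸ (Relation.ReflTransGen.refl : F₀ ∈ 𝓕))⟩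
    (by
      rw [IsConnected, hfac]
      intro F hF G hG
      refine Relation.ReflTransGen.trans ?_ (hchain G hG)
      refine Relation.ReflTransGen.mono ?_ _ _ (Relation.reflTransGen_swap.2 (hchain F hF))
      exact fun A B h => ⟨h.2.1, h.1, Finset.inter_comm B A ▸ h.2.2⟩)
  rw [IsLeaf, hfac] at hFleaf
  obtain ⟨hF, hleaf⟩ := hFleaf
  have hedge : ∀ {v a}, v ∈ F → a ∈ S → Δ.edgeGraph.Adj v a → {v, a} ∈ 𝓕 := by
    intro v a hv ha hva
    refine Relation.ReflTransGen.tail hF ⟨h𝓕 F hF, ⟨hva.2, ?_⟩, v, ?_⟩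
    · exact Finset.insert_subset ((h𝓕 F hF).2 hv) (Finset.singleton_subset_iff.2 ha)
    · simp [hv]
  have hfree : ∃ v ∈ F, ∀ H ∈ 𝓕, v ∈ H → H = F := by
    obtain ⟨x, y, hxy, rfl⟩ := Finset.card_eq_two.1 (hcard F (h𝓕 F hF).1)
    rcases hleaf with h | ⟨G, hG, hGF, h⟩
    · refine ⟨x, by simp, fun H hH _ => ?_⟩
      rw [h] at hH
      exact hH
    -- If both endpoints lay on other edges, the edge G of the leaf condition would contain both and
    -- equal F.
    · by_contra! hcon
      obtain ⟨H, hH, hxH, hHF⟩ := hcon x (by simp)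
      obtain ⟨H', hH', hyH', hHF'⟩ := hcon y (by simp)
      have hx : x ∈ G := (Finset.mem_inter.1 (h H hH hHF (by simp [hxH]))).2
      have hy : y ∈ G := (Finset.mem_inter.1 (h H' hH' hHF' (by simp [hyH']))).2
      refine hGF (Finset.eq_of_subset_of_card_le
        (Finset.insert_subset hx (Finset.singleton_subset_iff.2 hy)) ?_).symm
      rw [hcard G (h𝓕 G hG).1, hcard _ (h𝓕 _ hF).1]
  obtain ⟨v, hv, hvF⟩ := hfree
  refine ⟨v, (h𝓕 F hF).2 hv, fun a ha b hb hva hvb => ?_⟩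
  have h1 := hvF _ (hedge hv ha hva) (by simp)
  have h2 := hvF _ (hedge hv hb hvb) (by simp)
  have : a ∈ ({v, b} : Finset V) := by rw [h2, ← h1]; simp
  rcases Finset.mem_insert.1 this with h | h
  · exact absurd h hva.1.symm
  · exact Finset.mem_singleton.1 h

theorem card_eq_two_of_mem_facets [Finite V] {Δ : PreAbstractSimplicialComplex V}
    (hdim : Δ.HasDimension 1) (hpure : Δ.IsPure) {F : Finset V} (hF : F ∈ Δ.facets) :
    F.card = 2 := by
  obtain ⟨⟨E, hE, hE2⟩, hmax⟩ := hdim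
  obtain ⟨E', hE', hEE'⟩ := Δ.exists_facet_superset hE
  rw [hpure F hF E' hE']
  refine le_antisymm (hmax ⟨E', mem_faces_of_mem_facets hE', rfl⟩) ?_
  exact hE2.symm.le.trans (Finset.card_le_card hEE')

end PreAbstractSimplicialComplex

/-! ### Operators on the Koszul complex of the polynomial ring -/

namespace Koszul.Model

noncomputable section

open Finsupp

variable (K : Type*) [Field K] (n : ℕ)

/-- The Koszul complex of the polynomial ring `K[x_1, …, x_n]`, as the space of finite sums of
terms `x ^ m ⊗ b` with `b` in the exterior algebra over `K`. -/
abbrev Chain : Type _ := (Fin n →₀ ℕ) →₀ ExteriorAlgebra K (Fin n → K)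

variable {K n}

/-- Multiplication by the variable `x_i`. -/
def up (i : Fin n) : Module.End K (Chain K n) :=
  Finsupp.lmapDomain _ K (· + single i 1)

/-- Division by the variable `x_i`, discarding the terms not divisible by it. -/
def down (i : Fin n) : Module.End K (Chain K n) :=
  Finsupp.lcomapDomain (· + single i 1) (add_left_injective _)

/-- Left multiplication by `e_i`. -/
def ext (i : Fin n) : Module.End K (Chain K n) :=
  Finsupp.mapRange.linearMap (LinearMap.mulLeft K (ExteriorAlgebra.ι K (Pi.single i 1)))

/-- Contraction with the `i`-th coordinate function. -/
def contr (i : Fin n) : Module.End K (Chain K n) :=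
  Finsupp.mapRange.linearMap (CliffordAlgebra.contractLeft (LinearMap.proj i))

/-- The Koszul differential. -/
def diff : Module.End K (Chain K n) := ∑ i, up i * contr i

theorem sub_add_single {m : Fin n →₀ ℕ} {i : Fin n} (h : m i ≠ 0) :
    m - single i 1 + single i 1 = m := by
  ext j
  by_cases hj : j = i
  · subst hj; simp; omega
  · simp [Ne.symm hj]

theorem up_apply (i : Fin n) (c : Chain K n) (m : Fin n →₀ ℕ) :
    up i c m = if m i = 0 then 0 else c (m - single i 1) := by
  split_ifs with h
  · refine Finsupp.mapDomain_of_notMem_range _ _ ?_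
    rintro ⟨m', rfl⟩
    simp at h
  · have hm : m = (m - single i 1) + single i 1 := by
      ext j
      by_cases hj : j = i
      · subst hj; simp; omega
      · simp [Ne.symm hj]
    conv_lhs => rw [hm]
    exact Finsupp.mapDomain_apply (add_left_injective _) _ _

theorem down_apply (i : Fin n) (c : Chain K n) (m : Fin n →₀ ℕ) :
    down i c m = c (m + single i 1) := rfl

theorem ext_apply (i : Fin n) (c : Chain K n) (m : Fin n →₀ ℕ) :
    ext i c m = ExteriorAlgebra.ι K (Pi.single i 1) * c m := rfl

theorem contr_apply (i : Fin n) (c : Chain K n) (m : Fin n →₀ ℕ) :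
    contr i c m = CliffordAlgebra.contractLeft (LinearMap.proj i) (c m) := rfl

theorem down_up_self (i : Fin n) (c : Chain K n) : down i (up i c) = c := by
  ext m
  simp [down_apply, up_apply]

theorem down_up_of_ne {i j : Fin n} (h : i ≠ j) (c : Chain K n) :
    down i (up j c) = up j (down i c) := by
  ext m
  have : (single i 1 : Fin n →₀ ℕ) j = 0 := by simp [h]
  simp only [down_apply, up_apply, Finsupp.add_apply, this, add_zero]
  split_ifs with h0
  · rfl
  · congr 1
    ext k
    by_cases hk : k = j
    · subst hk; simp [this]
    · simp [Ne.symm hk]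

/-- This idempotent cuts out the terms divisible by x_i; its complement is what makes `proj0` appear
in the homotopy formula. -/
theorem up_down_apply (i : Fin n) (c : Chain K n) (m : Fin n →₀ ℕ) :
    up i (down i c) m = if m i = 0 then 0 else c m := by
  rw [up_apply]
  split_ifs with h
  · rfl
  · rw [down_apply, sub_add_single h]

theorem up_comm (i j : Fin n) (c : Chain K n) : up i (up j c) = up j (up i c) := by
  simp only [up, Finsupp.lmapDomain_apply]
  rw [← Finsupp.mapDomain_comp, ← Finsupp.mapDomain_comp]
  congr 1
  funext m
  exact add_right_comm _ _ _

theorem down_comm (i j : Fin n) (c : Chain K n) : down i (down j c) = down j (down i c) := by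
  ext m
  simp only [down_apply, add_right_comm]

theorem ext_up (i j : Fin n) (c : Chain K n) : ext i (up j c) = up j (ext i c) := by
  ext m
  simp only [ext_apply, up_apply]
  split_ifs <;> simp

theorem ext_down (i j : Fin n) (c : Chain K n) : ext i (down j c) = down j (ext i c) := by
  ext m
  rfl

theorem contr_up (i j : Fin n) (c : Chain K n) : contr i (up j c) = up j (contr i c) := by
  ext m
  simp only [contr_apply, up_apply]
  split_ifs <;> simp

theorem contr_down (i j : Fin n) (c : Chain K n) : contr i (down j c) = down j (contr i c) := by
  ext m
  rfl

theorem ext_ext_self (i : Fin n) (c : Chain K n) : ext i (ext i c) = 0 := by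
  ext m
  simp only [ext_apply, ← mul_assoc, ExteriorAlgebra.ι_sq_zero, zero_mul, Finsupp.zero_apply]

theorem ext_comm (i j : Fin n) (c : Chain K n) : ext i (ext j c) = -ext j (ext i c) := by
  ext m
  simp only [ext_apply, ← mul_assoc, Finsupp.neg_apply, ← neg_mul]
  congr 1
  rw [neg_mul]
  exact eq_neg_of_add_eq_zero_left (ExteriorAlgebra.ι_add_mul_swap (R := K) (M := Fin n → K)
    (Pi.single i 1) (Pi.single j 1))

theorem contr_contr_self (i : Fin n) (c : Chain K n) : contr i (contr i c) = 0 := by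
  ext m
  exact CliffordAlgebra.contractLeft_contractLeft _ _

theorem contr_comm (i j : Fin n) (c : Chain K n) :
    contr i (contr j c) = -contr j (contr i c) := by
  ext m
  exact CliffordAlgebra.contractLeft_comm _ _ _

theorem contr_ext_self (i : Fin n) (c : Chain K n) :
    contr i (ext i c) = c - ext i (contr i c) := by
  ext m
  simp only [contr_apply, ext_apply, Finsupp.sub_apply]
  exact (CliffordAlgebra.contractLeft_ι_mul (Q := (0 : QuadraticForm K (Fin n → K)))
    (d := LinearMap.proj i) (Pi.single i 1) (c m)).trans (by simp)

theorem contr_ext_of_ne {i j : Fin n} (h : i ≠ j) (c : Chain K n) :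
    contr i (ext j c) = -ext j (contr i c) := by
  ext m
  simp only [contr_apply, ext_apply, Finsupp.neg_apply]
  exact (CliffordAlgebra.contractLeft_ι_mul (Q := (0 : QuadraticForm K (Fin n → K)))
    (d := LinearMap.proj i) (Pi.single j 1) (c m)).trans (by simp [h])

theorem diff_apply (c : Chain K n) : diff c = ∑ i, up i (contr i c) := by
  simp [diff, LinearMap.sum_apply]

theorem diff_up (i : Fin n) (c : Chain K n) : diff (up i c) = up i (diff c) := by
  simp only [diff_apply, map_sum]
  exact Finset.sum_congr rfl fun j _ => by rw [contr_up, up_comm]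

theorem contr_diff (i : Fin n) (c : Chain K n) : contr i (diff c) = -diff (contr i c) := by
  simp only [diff_apply, map_sum, ← Finset.sum_neg_distrib]
  exact Finset.sum_congr rfl fun j _ => by rw [contr_up, contr_comm, map_neg]

theorem diff_ext (i : Fin n) (c : Chain K n) : diff (ext i c) = up i c - ext i (diff c) := by
  simp only [diff_apply, map_sum]
  rw [← Finset.add_sum_erase _ _ (Finset.mem_univ i),
    ← Finset.add_sum_erase _ (fun j => ext i (up j (contr j c))) (Finset.mem_univ i),
    contr_ext_self, map_sub, ext_up, sub_add_eq_sub_sub, sub_eq_add_neg _ (Finset.sum _ _),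
    ← Finset.sum_neg_distrib]
  congr 1
  refine Finset.sum_congr rfl fun j hj => ?_
  rw [contr_ext_of_ne (Finset.ne_of_mem_erase hj), ext_up, map_neg]

/-- Division by x_i commutes with every summand of the differential except the i-th, where it undoes
the multiplication by x_i; the last two terms are that discrepancy. -/
theorem down_diff (i : Fin n) (c : Chain K n) :
    down i (diff c) = diff (down i c) + contr i c - up i (down i (contr i c)) := by
  simp only [diff_apply, map_sum]
  rw [← Finset.add_sum_erase _ _ (Finset.mem_univ i),
    ← Finset.add_sum_erase _ (fun j => up j (contr j (down i c))) (Finset.mem_univ i),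
    down_up_self, contr_down]
  rw [Finset.sum_congr rfl fun j hj => by
    rw [down_up_of_ne (Finset.ne_of_mem_erase hj).symm, ← contr_down]]
  abel

/-! ### Degrees in one variable and the contracting homotopy -/

/-- The projection onto the part of degree `0` in the `i`-th variable, where both `x_i` and `e_i`
have degree `1`. -/
def proj0 (i : Fin n) : Module.End K (Chain K n) := (1 - up i * down i) * (contr i * ext i)

/-- The projection onto the part of degree `1` in the `i`-th variable. -/
def proj1 (i : Fin n) : Module.End K (Chain K n) :=
  (up i * down i - up i * up i * (down i * down i)) * (contr i * ext i) +
    (1 - up i * down i) * (ext i * contr i)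

/-- The contracting homotopy for the part of positive degree in the `i`-th variable. -/
def htpy (i : Fin n) : Module.End K (Chain K n) := ext i * down i

theorem htpy_apply (i : Fin n) (c : Chain K n) : htpy i c = ext i (down i c) := rfl

theorem proj0_apply (i : Fin n) (c : Chain K n) :
    proj0 i c = c - ext i (contr i c) - up i (down i (c - ext i (contr i c))) := by
  simp [proj0, contr_ext_self]

theorem proj1_apply (i : Fin n) (c : Chain K n) :
    proj1 i c = up i (down i (c - ext i (contr i c))) -
      up i (up i (down i (down i (c - ext i (contr i c))))) +
      (ext i (contr i c) - up i (down i (ext i (contr i c)))) := by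
  simp [proj1, contr_ext_self]

/-- The homotopy formula. -/
theorem diff_htpy_add (i : Fin n) (c : Chain K n) :
    diff (htpy i c) + htpy i (diff c) = c - proj0 i c := by
  rw [htpy_apply, htpy_apply, diff_ext, down_diff, proj0_apply]
  simp only [map_add, map_sub, ext_up, ext_down]
  abel

theorem up_down_diff (i : Fin n) (c : Chain K n) :
    up i (down i (diff c)) = diff (up i (down i c)) + up i (contr i c) -
      up i (up i (down i (contr i c))) := by
  rw [down_diff, map_sub, map_add, diff_up]

/-- The homotopy formula for the part of degree at least `2`. -/
theorem diff_up_down_htpy_add (i : Fin n) (c : Chain K n) :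
    diff (up i (down i (htpy i c))) + up i (down i (htpy i (diff c))) =
      c - proj0 i c - proj1 i c := by
  have h := up_down_diff i (htpy i c)
  rw [show diff (up i (down i (htpy i c))) = up i (down i (diff (htpy i c))) -
    up i (contr i (htpy i c)) + up i (up i (down i (contr i (htpy i c)))) by rw [h]; abel,
    show up i (down i (htpy i (diff c))) = up i (down i (c - proj0 i c)) -
      up i (down i (diff (htpy i c))) by rw [← diff_htpy_add]; simp]
  rw [proj0_apply, proj1_apply, htpy_apply, contr_ext_self, contr_down]
  simp only [map_sub, down_up_self, ext_down]
  abel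

theorem diff_diff (c : Chain K n) : diff (diff c) = 0 := by
  simp only [diff_apply, map_sum, contr_up]
  rw [← Finset.sum_product']
  refine Finset.sum_involution (fun p _ => p.swap) ?_ ?_ (fun _ _ => Finset.mem_univ _)
    (fun _ _ => Prod.swap_swap _)
  · rintro ⟨i, j⟩ -
    dsimp only [Prod.swap]
    rw [contr_comm, up_comm, map_neg, map_neg, neg_add_cancel]
  · rintro ⟨i, j⟩ - h h'
    obtain rfl : j = i := congrArg Prod.fst h'
    simp [contr_contr_self] at h

/-- The homotopy formula writes `proj0` as the identity minus dh + hd, and dh + hd commutes with d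
because d² = 0. -/
theorem diff_proj0 (i : Fin n) (c : Chain K n) : diff (proj0 i c) = proj0 i (diff c) := by
  have h1 := congrArg diff (diff_htpy_add i c)
  have h2 := diff_htpy_add i (diff c)
  rw [diff_diff, map_zero, add_zero] at h2
  rw [map_add, diff_diff, zero_add, map_sub] at h1
  exact sub_right_injective (h1.symm.trans h2)

theorem diff_proj1 (i : Fin n) (c : Chain K n) : diff (proj1 i c) = proj1 i (diff c) := by
  have h1 := congrArg diff (diff_up_down_htpy_add i c)
  have h2 := diff_up_down_htpy_add i (diff c)
  rw [diff_diff, map_zero, map_zero, map_zero, add_zero] at h2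
  rw [map_add, diff_diff, zero_add, map_sub, map_sub, diff_proj0] at h1
  exact sub_right_injective (h1.symm.trans h2)

theorem proj0_proj0 (i : Fin n) (c : Chain K n) : proj0 i (proj0 i c) = proj0 i c := by
  simp only [proj0_apply, map_sub, down_up_self, ext_up, ext_down, contr_down, contr_up,
    contr_ext_self, contr_contr_self, map_zero]
  abel

theorem proj1_proj1 (i : Fin n) (c : Chain K n) : proj1 i (proj1 i c) = proj1 i c := by
  simp only [proj1_apply, map_sub, map_add, down_up_self, ext_up, ext_down, contr_down, contr_up,
    contr_ext_self, contr_contr_self, map_zero]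
  abel

/-- Division and contraction lower the degree in the i-th variable by one, and multiplication by e_i
raises it by one; this and the next two lemmas record the shift. -/
theorem proj0_down (i : Fin n) (c : Chain K n) : proj0 i (down i c) = down i (proj1 i c) := by
  simp only [proj0_apply, proj1_apply, map_sub, map_add, down_up_self, ext_down,
    contr_down]
  abel

theorem proj0_contr (i : Fin n) (c : Chain K n) : proj0 i (contr i c) = contr i (proj1 i c) := by
  simp only [proj0_apply, proj1_apply, map_sub, map_add,
    contr_down, contr_up, contr_ext_self, contr_contr_self, map_zero]
  abel

theorem proj1_ext (i : Fin n) (c : Chain K n) : proj1 i (ext i c) = ext i (proj0 i c) := by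
  simp only [proj0_apply, proj1_apply, map_sub, ext_up, ext_down, contr_ext_self, ext_ext_self,
    map_zero]
  abel

theorem down_proj0 (i : Fin n) (c : Chain K n) : down i (proj0 i c) = 0 := by
  simp [proj0_apply, down_up_self]

theorem contr_proj0 (i : Fin n) (c : Chain K n) : contr i (proj0 i c) = 0 := by
  simp [proj0_apply, contr_up, contr_down, contr_ext_self, contr_contr_self]

theorem proj0_proj1 (i : Fin n) (c : Chain K n) : proj0 i (proj1 i c) = 0 := by
  simp only [proj0_apply, proj1_apply, map_sub, map_add, down_up_self, ext_up, ext_down,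
    contr_down, contr_up, contr_ext_self, contr_contr_self, map_zero]
  abel

/-! ### Independence of different variables -/

/-- Operators that commute with the projections in the `j`-th variable. -/
def evenCommutant (j : Fin n) : Subalgebra K (Module.End K (Chain K n)) :=
  Subalgebra.centralizer K {up j * down j, up j * up j * (down j * down j), ext j * contr j,
    contr j * ext j}

theorem sub_mem_evenCommutant {j : Fin n} {f g : Module.End K (Chain K n)}
    (hf : f ∈ evenCommutant j) (hg : g ∈ evenCommutant j) : f - g ∈ evenCommutant j := by
  have : f - g = f + (-1 : K) • g := by
    refine LinearMap.ext fun c => ?_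
    rw [LinearMap.sub_apply, LinearMap.add_apply, LinearMap.smul_apply, neg_smul, one_smul,
      sub_eq_add_neg]
  rw [this]
  exact add_mem hf (Subalgebra.smul_mem _ hg _)

theorem commute_proj0 {j : Fin n} {f : Module.End K (Chain K n)} (hf : f ∈ evenCommutant j)
    (c : Chain K n) : proj0 j (f c) = f (proj0 j c) := by
  simp only [evenCommutant, Subalgebra.mem_centralizer_iff, Set.mem_insert_iff,
    Set.mem_singleton_iff, forall_eq_or_imp, forall_eq] at hf
  obtain ⟨h1, -, -, h4⟩ := hf
  have h1 (c) : up j (down j (f c)) = f (up j (down j c)) := LinearMap.congr_fun h1 c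
  have h4 (c) : contr j (ext j (f c)) = f (contr j (ext j c)) := LinearMap.congr_fun h4 c
  change contr j (ext j (f c)) - up j (down j (contr j (ext j (f c)))) =
    f (contr j (ext j c) - up j (down j (contr j (ext j c))))
  rw [h4, h1, map_sub]

theorem commute_proj1 {j : Fin n} {f : Module.End K (Chain K n)} (hf : f ∈ evenCommutant j)
    (c : Chain K n) : proj1 j (f c) = f (proj1 j c) := by
  simp only [evenCommutant, Subalgebra.mem_centralizer_iff, Set.mem_insert_iff,
    Set.mem_singleton_iff, forall_eq_or_imp, forall_eq] at hf
  obtain ⟨h1, h2, h3, h4⟩ := hf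
  have h1 (c) : up j (down j (f c)) = f (up j (down j c)) := LinearMap.congr_fun h1 c
  have h2 (c) : up j (up j (down j (down j (f c)))) = f (up j (up j (down j (down j c)))) :=
    LinearMap.congr_fun h2 c
  have h3 (c) : ext j (contr j (f c)) = f (ext j (contr j c)) := LinearMap.congr_fun h3 c
  have h4 (c) : contr j (ext j (f c)) = f (contr j (ext j c)) := LinearMap.congr_fun h4 c
  simp only [proj1_apply, ← contr_ext_self]
  rw [h4, h1, h2, h3, h1, map_add, map_sub, map_sub]

theorem up_mem_evenCommutant {i j : Fin n} (h : i ≠ j) :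
    (up i : Module.End K (Chain K n)) ∈ evenCommutant j := by
  simp only [evenCommutant, Subalgebra.mem_centralizer_iff, Set.mem_insert_iff,
    Set.mem_singleton_iff, forall_eq_or_imp, forall_eq]
  refine ⟨?_, ?_, ?_, ?_⟩ <;> refine LinearMap.ext fun c => ?_ <;>
    simp [down_up_of_ne h.symm, up_comm i j, ext_up, contr_up]

theorem down_mem_evenCommutant {i j : Fin n} (h : i ≠ j) :
    (down i : Module.End K (Chain K n)) ∈ evenCommutant j := by
  simp only [evenCommutant, Subalgebra.mem_centralizer_iff, Set.mem_insert_iff,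
    Set.mem_singleton_iff, forall_eq_or_imp, forall_eq]
  refine ⟨?_, ?_, ?_, ?_⟩ <;> refine LinearMap.ext fun c => ?_ <;>
    simp [down_up_of_ne h, down_comm i j, ext_down, contr_down]

/-- The operator anticommutes with `ext j` and `contr j`, but these occur in pairs in the generators
of the centralizer, so the signs cancel. -/
theorem ext_mem_evenCommutant {i j : Fin n} (h : i ≠ j) :
    (ext i : Module.End K (Chain K n)) ∈ evenCommutant j := by
  simp only [evenCommutant, Subalgebra.mem_centralizer_iff, Set.mem_insert_iff,
    Set.mem_singleton_iff, forall_eq_or_imp, forall_eq]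
  refine ⟨?_, ?_, ?_, ?_⟩ <;> refine LinearMap.ext fun c => ?_ <;>
    simp [ext_down, ext_up, ext_comm i j, contr_ext_of_ne h.symm, contr_ext_self]

theorem contr_mem_evenCommutant {i j : Fin n} (h : i ≠ j) :
    (contr i : Module.End K (Chain K n)) ∈ evenCommutant j := by
  simp only [evenCommutant, Subalgebra.mem_centralizer_iff, Set.mem_insert_iff,
    Set.mem_singleton_iff, forall_eq_or_imp, forall_eq]
  refine ⟨?_, ?_, ?_, ?_⟩ <;> refine LinearMap.ext fun c => ?_ <;>
    simp [contr_down, contr_up, contr_comm i j, contr_ext_of_ne h]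

end

end Koszul.Model

/-! ### Comparison with the Koszul complex over the quotient ring -/

namespace Koszul.Model

noncomputable section

open Finsupp TensorProduct

variable {K A : Type*} [Field K] [CommRing A] [Algebra K A] {n : ℕ}

/-- The scalar extension map of exterior algebras. -/
def incl (K A : Type*) [Field K] [CommRing A] [Algebra K A] (n : ℕ) :
    ExteriorAlgebra K (Fin n → K) →ₐ[K] ExteriorAlgebra A (Fin n → A) :=
  ExteriorAlgebra.lift K ⟨(ExteriorAlgebra.ι A).restrictScalars K ∘ₗ
    (Algebra.linearMap K A).compLeft (Fin n), fun _ => ExteriorAlgebra.ι_sq_zero _⟩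

theorem incl_ι (v : Fin n → K) :
    incl K A n (ExteriorAlgebra.ι K v) = ExteriorAlgebra.ι A (fun j => algebraMap K A (v j)) :=
  ExteriorAlgebra.lift_ι_apply _ _ _ _

theorem incl_ι_single (i : Fin n) :
    incl K A n (ExteriorAlgebra.ι K (Pi.single i 1)) = ExteriorAlgebra.ι A (Pi.single i 1) := by
  rw [incl_ι]
  congr 1
  funext j
  by_cases h : j = i
  · subst h; simp
  · simp [h]

variable (q : MvPolynomial (Fin n) K →ₐ[K] A)

/-- The images of the variables. -/
def xs (i : Fin n) : A := q (MvPolynomial.X i)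

/-- The image of the monomial `x ^ m`. -/
def mono (m : Fin n →₀ ℕ) : A := q (MvPolynomial.monomial m 1)

theorem mono_add_single (m : Fin n →₀ ℕ) (i : Fin n) :
    mono q (m + single i 1) = xs q i * mono q m := by
  rw [mono, mono, xs, ← map_mul, MvPolynomial.X, MvPolynomial.monomial_mul, add_comm, one_mul]

/-- The map from the Koszul complex of the polynomial ring to the one of the quotient by `I`. -/
def realize : Chain K n →ₗ[K] ExteriorAlgebra A (Fin n → A) :=
  Finsupp.lsum K fun m => Algebra.lsmul K K (ExteriorAlgebra A (Fin n → A)) (mono q m) ∘ₗ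
    (incl K A n).toLinearMap

theorem realize_single (m : Fin n →₀ ℕ) (b : ExteriorAlgebra K (Fin n → K)) :
    realize q (single m b) = mono q m • incl K A n b := by
  simp [realize]

theorem realize_up (i : Fin n) (c : Chain K n) : realize q (up i c) = xs q i • realize q c := by
  induction c using Finsupp.induction_linear with
  | zero => simp
  | add c c' h h' => rw [map_add, map_add, h, h', map_add, smul_add]
  | single m b =>
    rw [up, Finsupp.lmapDomain_apply, Finsupp.mapDomain_single, realize_single, realize_single,
      mono_add_single, mul_smul]

theorem realize_ext (i : Fin n) (c : Chain K n) :
    realize q (ext i c) = ExteriorAlgebra.ι _ (Pi.single i 1) * realize q c := by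
  induction c using Finsupp.induction_linear with
  | zero => simp
  | add c c' h h' => rw [map_add, map_add, h, h', map_add, mul_add]
  | single m b =>
    rw [ext, Finsupp.mapRange.linearMap_apply, Finsupp.mapRange_single, realize_single,
      realize_single, LinearMap.mulLeft_apply, map_mul, incl_ι_single, mul_smul_comm]

theorem contractLeft_ι_mul {R M : Type*} [CommRing R] [AddCommGroup M] [Module R M]
    (f : Module.Dual R M) (v : M) (b : ExteriorAlgebra R M) :
    CliffordAlgebra.contractLeft f (ExteriorAlgebra.ι R v * b) =
      f v • b - ExteriorAlgebra.ι R v * CliffordAlgebra.contractLeft f b :=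
  CliffordAlgebra.contractLeft_ι_mul (Q := (0 : QuadraticForm R M)) (d := f) v b

theorem d_incl (b : ExteriorAlgebra K (Fin n → K)) :
    d (xs q) (incl K A n b) =
      ∑ i, xs q i • incl K A n (CliffordAlgebra.contractLeft (LinearMap.proj i) b) := by
  induction b using CliffordAlgebra.left_induction with
  | algebraMap r =>
    rw [AlgHom.commutes, IsScalarTower.algebraMap_apply K A, d_algebraMap]
    refine (Finset.sum_eq_zero fun i _ => ?_).symm
    rw [CliffordAlgebra.contractLeft_algebraMap, map_zero, smul_zero]
  | add b b' h h' => simp only [map_add, h, h', smul_add, Finset.sum_add_distrib]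
  | ι_mul b v h =>
    change d (xs q) (incl K A n (ExteriorAlgebra.ι K v * b)) = ∑ i, xs q i • incl K A n
      (CliffordAlgebra.contractLeft (LinearMap.proj i) (ExteriorAlgebra.ι K v * b))
    rw [map_mul, incl_ι, d_ι_mul, h]
    simp only [contractLeft_ι_mul, map_sub, smul_sub, Finset.sum_sub_distrib,
      map_mul, map_smul, incl_ι]
    congr 1
    · rw [Fintype.linearCombination_apply, Finset.sum_smul]
      refine Finset.sum_congr rfl fun i _ => ?_
      rw [LinearMap.proj_apply, smul_eq_mul, mul_comm, mul_smul, algebraMap_smul]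
    · rw [Finset.mul_sum]
      refine Finset.sum_congr rfl fun i _ => ?_
      rw [mul_smul_comm]

theorem d_realize (c : Chain K n) : d (xs q) (realize q c) = realize q (diff c) := by
  induction c using Finsupp.induction_linear with
  | zero => simp
  | add c c' h h' => rw [map_add, map_add, h, h', map_add, map_add]
  | single m b =>
    rw [realize_single, map_smul, d_incl, diff_apply, map_sum, Finset.smul_sum]
    refine Finset.sum_congr rfl fun i _ => ?_
    rw [realize_up, contr, Finsupp.mapRange.linearMap_apply, Finsupp.mapRange_single,
      realize_single, smul_comm]

theorem smul_mem_range_realize (hq : Function.Surjective q) (a : A)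
    {z : ExteriorAlgebra A (Fin n → A)}
    (hz : z ∈ LinearMap.range (realize q)) : a • z ∈ LinearMap.range (realize q) := by
  obtain ⟨p, rfl⟩ := hq a
  induction p using MvPolynomial.induction_on generalizing z with
  | C r =>
    rw [← MvPolynomial.algebraMap_eq, AlgHom.commutes, algebraMap_smul]
    exact Submodule.smul_mem _ _ hz
  | add p p' hp hp' => rw [map_add, add_smul]; exact add_mem (hp hz) (hp' hz)
  | mul_X p i hp =>
    rw [map_mul, mul_smul]
    refine hp ?_
    obtain ⟨c, rfl⟩ := hz
    exact ⟨up i c, realize_up q i c⟩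

theorem realize_surjective (hq : Function.Surjective q) : Function.Surjective (realize q) := by
  intro z
  change z ∈ LinearMap.range (realize q)
  induction z using CliffordAlgebra.left_induction with
  | algebraMap a =>
    rw [Algebra.algebraMap_eq_smul_one]
    refine smul_mem_range_realize q hq a ⟨single 0 1, ?_⟩
    rw [realize_single, map_one, mono, MvPolynomial.monomial_zero', map_one, map_one, one_smul]
  | add z z' h h' => exact add_mem h h'
  | ι_mul z v h =>
    change ExteriorAlgebra.ι A v * z ∈ _
    have hv : v = ∑ i, v i • (Pi.single i 1 : Fin n → A) := by
      funext j
      simp [Finset.sum_apply, Pi.single_apply]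
    rw [hv, map_sum, Finset.sum_mul]
    refine sum_mem fun i _ => ?_
    rw [map_smul, smul_mul_assoc]
    refine smul_mem_range_realize q hq _ ?_
    obtain ⟨c, rfl⟩ := h
    exact ⟨ext i c, realize_ext q i c⟩

/-- The comparison map from the exterior algebra over the quotient ring to the scalar extension of
the exterior algebra over `K`. -/
def toTensor (K A : Type*) [Field K] [CommRing A] [Algebra K A] (n : ℕ) :
    ExteriorAlgebra A (Fin n → A) →ₐ[A] A ⊗[K] ExteriorAlgebra K (Fin n → K) :=
  ExteriorAlgebra.lift _ ⟨Fintype.linearCombination _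
    fun i => 1 ⊗ₜ ExteriorAlgebra.ι K (Pi.single i 1), fun v => by
      rw [Fintype.linearCombination_apply, Finset.sum_mul_sum, ← Finset.sum_product']
      refine Finset.sum_involution (fun p _ => p.swap) ?_ ?_ (fun _ _ => Finset.mem_univ _)
        (fun _ _ => Prod.swap_swap _)
      · rintro ⟨i, j⟩ -
        simp only [Prod.swap, smul_mul_smul_comm, Algebra.TensorProduct.tmul_mul_tmul, one_mul]
        rw [mul_comm (v j), ← smul_add, ← tmul_add, ExteriorAlgebra.ι_add_mul_swap, tmul_zero,
          smul_zero]
      · rintro ⟨i, j⟩ - h h'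
        obtain rfl : j = i := congrArg Prod.fst h'
        simp at h⟩

theorem toTensor_incl (b : ExteriorAlgebra K (Fin n → K)) :
    toTensor K A n (incl K A n b) = 1 ⊗ₜ b := by
  have : ((toTensor K A n).restrictScalars K).comp (incl K A n) =
      Algebra.TensorProduct.includeRight := by
    refine ExteriorAlgebra.hom_ext (LinearMap.pi_ext' fun i => LinearMap.ext_ring ?_)
    change toTensor K A n (incl K A n (ExteriorAlgebra.ι K (Pi.single i 1))) =
      1 ⊗ₜ ExteriorAlgebra.ι K (Pi.single i 1)
    rw [incl_ι_single, toTensor, ExteriorAlgebra.lift_ι_apply,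
      Fintype.linearCombination_apply_single, one_smul]
  exact DFunLike.congr_fun this b

/-- The chains of the polynomial ring with coefficients in the kernel of `q`,
when this is a monomial ideal. -/
def null : Submodule K (Chain K n) where
  carrier := {c | ∀ m, mono q m ≠ 0 → c m = 0}
  add_mem' h h' m hm := by rw [Finsupp.add_apply, h m hm, h' m hm, add_zero]
  zero_mem' _ _ := rfl
  smul_mem' r c h m hm := by rw [Finsupp.smul_apply, h m hm, smul_zero]

theorem realize_eq_zero_of_mem_null {c : Chain K n} (hc : c ∈ null q) : realize q c = 0 := by
  rw [realize, Finsupp.lsum_apply]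
  refine Finset.sum_eq_zero fun m hm => ?_
  have : mono q m = 0 := by
    by_contra h
    exact Finsupp.mem_support_iff.1 hm (hc m h)
  simp [this]

/-- Linear functionals φ separate points of the exterior algebra over K. Applying φ to the exterior
factor turns the vanishing of the realization into q p = 0 for a polynomial p with coefficients φ (c
m), and `hq` says that the kernel of q is a monomial ideal. -/
theorem mem_null_of_realize_eq_zero
    (hq : ∀ p, q p = 0 → ∀ m ∈ p.support, mono q m = 0)
    {c : Chain K n} (hc : realize q c = 0) : c ∈ null q := by
  intro m hm
  rw [← Module.forall_dual_apply_eq_zero_iff K]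
  intro φ
  let g : A ⊗[K] ExteriorAlgebra K (Fin n → K) →ₗ[K]
      A :=
    (TensorProduct.rid K _).toLinearMap ∘ₗ φ.lTensor A
  let p : Chain K n →ₗ[K] MvPolynomial (Fin n) K :=
    Finsupp.lsum K fun m => MvPolynomial.monomial m ∘ₗ φ
  have hcoeff : (p c).coeff m = φ (c m) := by
    clear hc
    induction c using Finsupp.induction_linear with
    | zero => simp
    | add c c' h h' => rw [map_add, MvPolynomial.coeff_add, Finsupp.add_apply, map_add, h, h']
    | single m' b =>
      simp only [p, Finsupp.lsum_single, LinearMap.comp_apply, MvPolynomial.coeff_monomial,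
        Finsupp.single_apply]
      split_ifs <;> simp
  have key : g (toTensor K A n (realize q c)) = q (p c) := by
    clear hcoeff hc
    induction c using Finsupp.induction_linear with
    | zero => simp
    | add c c' h h' => simp only [map_add, h, h']
    | single m b =>
      rw [realize_single, map_smul, toTensor_incl, TensorProduct.smul_tmul']
      simp only [g, p, Finsupp.lsum_single, LinearMap.comp_apply, LinearMap.lTensor_tmul,
        LinearEquiv.coe_coe, TensorProduct.rid_tmul, smul_eq_mul, mul_one, mono]
      rw [← mul_one (φ b), ← smul_eq_mul, ← MvPolynomial.smul_monomial, smul_eq_mul, mul_one,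
        map_smul]
  rw [hc, map_zero, map_zero] at key
  have h := hq _ key.symm m
  rw [MvPolynomial.mem_support_iff, hcoeff] at h
  by_contra h0
  exact hm (h h0)

end

end Koszul.Model

/-! ### Exterior elements killed by all contractions -/

namespace Koszul.Model

noncomputable section

open Finsupp

section Scalars

variable {K : Type*} [Field K] {n : ℕ}

/-- The projection onto the part of the exterior algebra not involving `e_i`. -/
def drop (i : Fin n) : Module.End K (ExteriorAlgebra K (Fin n → K)) :=
  CliffordAlgebra.contractLeft (LinearMap.proj i) ∘ₗ
    LinearMap.mulLeft K (ExteriorAlgebra.ι K (Pi.single i 1))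

theorem drop_apply (i : Fin n) (b : ExteriorAlgebra K (Fin n → K)) :
    drop i b = b - ExteriorAlgebra.ι K (Pi.single i 1) *
      CliffordAlgebra.contractLeft (LinearMap.proj i) b := by
  rw [drop, LinearMap.comp_apply, LinearMap.mulLeft_apply, contractLeft_ι_mul,
    LinearMap.proj_apply, Pi.single_eq_same, one_smul]

theorem drop_ι_mul_self (i : Fin n) (b : ExteriorAlgebra K (Fin n → K)) :
    drop i (ExteriorAlgebra.ι K (Pi.single i 1) * b) = 0 := by
  rw [drop, LinearMap.comp_apply, LinearMap.mulLeft_apply, ← mul_assoc,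
    ExteriorAlgebra.ι_sq_zero, zero_mul, map_zero]

theorem drop_ι_mul_of_ne {i j : Fin n} (h : i ≠ j) (b : ExteriorAlgebra K (Fin n → K)) :
    drop i (ExteriorAlgebra.ι K (Pi.single j 1) * b) =
      ExteriorAlgebra.ι K (Pi.single j 1) * drop i b := by
  have := eq_neg_of_add_eq_zero_left (ExteriorAlgebra.ι_add_mul_swap (R := K) (M := Fin n → K)
    (Pi.single i 1) (Pi.single j 1))
  rw [drop_apply, drop_apply, contractLeft_ι_mul, mul_sub, mul_sub, ← mul_assoc, this, neg_mul,
    mul_assoc]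
  simp [h]

theorem prod_drop_ι_mul (j : Fin n) (l : List (Fin n)) (b : ExteriorAlgebra K (Fin n → K)) :
    ∃ b' : ExteriorAlgebra K (Fin n → K), (l.map drop).prod
      (ExteriorAlgebra.ι K (Pi.single j 1) * b) =
      ExteriorAlgebra.ι K (Pi.single j 1) * b' ∧ (j ∈ l → b' = 0) := by
  induction l with
  | nil => exact ⟨b, by simp⟩
  | cons i l ih =>
    obtain ⟨b', h, h'⟩ := ih
    rw [List.map_cons, List.prod_cons, Module.End.mul_apply, h]
    by_cases hij : i = j
    · subst hij
      exact ⟨0, by rw [drop_ι_mul_self, mul_zero], fun _ => rfl⟩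
    · refine ⟨drop i b', drop_ι_mul_of_ne hij _, fun hj => ?_⟩
      rw [h' ((List.mem_cons.1 hj).resolve_left (Ne.symm hij)), map_zero]

/-- The composite of all `drop i` fixes b, because its contractions vanish, while it kills every
multiple of some e_j. Hence it sends every element to a scalar. -/
theorem exists_algebraMap_of_contractLeft_eq_zero {b : ExteriorAlgebra K (Fin n → K)}
    (hb : ∀ i : Fin n, CliffordAlgebra.contractLeft (LinearMap.proj i) b = 0) :
    ∃ r : K, algebraMap K _ r = b := by
  have h1 : ∀ l : List (Fin n), (l.map drop).prod b = b := by
    intro l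
    induction l with
    | nil => rfl
    | cons i l ih =>
      rw [List.map_cons, List.prod_cons, Module.End.mul_apply, ih, drop_apply, hb, mul_zero,
        sub_zero]
  rw [← h1 Finset.univ.toList]
  clear h1 hb
  induction b using CliffordAlgebra.left_induction with
  | algebraMap r =>
    refine ⟨r, ?_⟩
    induction (Finset.univ : Finset (Fin n)).toList with
    | nil => rfl
    | cons i l ih =>
      rw [List.map_cons, List.prod_cons, Module.End.mul_apply, ← ih, drop_apply,
        CliffordAlgebra.contractLeft_algebraMap, mul_zero, sub_zero]
  | add b b' h h' =>
    obtain ⟨r, hr⟩ := h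
    obtain ⟨r', hr'⟩ := h'
    exact ⟨r + r', by rw [map_add, map_add, hr, hr']⟩
  | ι_mul b v h =>
    refine ⟨0, ?_⟩
    change _ = (List.map drop _).prod (ExteriorAlgebra.ι K v * b)
    have hv : v = ∑ i, v i • (Pi.single i 1 : Fin n → K) := by
      funext j
      simp [Finset.sum_apply, Pi.single_apply]
    rw [hv, map_sum, Finset.sum_mul, map_sum, map_zero]
    refine (Finset.sum_eq_zero fun i _ => ?_).symm
    obtain ⟨b', h, h'⟩ := prod_drop_ι_mul i Finset.univ.toList b
    rw [map_smul, smul_mul_assoc, map_smul, h, h' (by simp), mul_zero, smul_zero]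

end Scalars

/-! ### Chains with coefficients in the edge ideal -/

variable {K A : Type*} [Field K] [CommRing A] [Algebra K A] {n : ℕ}
  {q : MvPolynomial (Fin n) K →ₐ[K] A}

theorem apply_eq_zero_of_down_eq_zero {c : Chain K n} {i : Fin n} (h : down i c = 0)
    {m : Fin n →₀ ℕ} (hm : m i ≠ 0) : c m = 0 := by
  rw [← sub_add_single hm, ← down_apply, h, Finsupp.zero_apply]

theorem up_mem_null {c : Chain K n} (hc : c ∈ null q) (i : Fin n) : up i c ∈ null q := by
  intro m hm
  rw [up_apply]
  split_ifs with h
  · rfl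
  · refine hc _ fun h0 => hm ?_
    rw [← sub_add_single h, mono_add_single, h0, mul_zero]

theorem ext_mem_null {c : Chain K n} (hc : c ∈ null q) (i : Fin n) : ext i c ∈ null q :=
  fun m hm => by rw [ext_apply, hc m hm, mul_zero]

theorem contr_mem_null {c : Chain K n} (hc : c ∈ null q) (i : Fin n) : contr i c ∈ null q :=
  fun m hm => by rw [contr_apply, hc m hm, map_zero]

theorem diff_mem_null {c : Chain K n} (hc : c ∈ null q) : diff c ∈ null q := by
  rw [diff_apply]
  exact sum_mem fun i _ => up_mem_null (contr_mem_null hc i) i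

theorem up_down_mem_null {c : Chain K n} (hc : c ∈ null q) (i : Fin n) :
    up i (down i c) ∈ null q := by
  intro m hm
  rw [up_down_apply, hc m hm, ite_self]

theorem proj0_mem_null {c : Chain K n} (hc : c ∈ null q) (i : Fin n) : proj0 i c ∈ null q := by
  rw [proj0_apply]
  have := sub_mem hc (ext_mem_null (contr_mem_null hc i) i)
  exact sub_mem this (up_down_mem_null this i)

/-- The ideal of relations of `q` is the edge ideal of the graph `G`, on monomials. -/
def EdgeRelations (q : MvPolynomial (Fin n) K →ₐ[K] A) (G : SimpleGraph (Fin n)) : Prop :=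
  ∀ m : Fin n →₀ ℕ, mono q m = 0 ↔ ∃ i j, G.Adj i j ∧ m i ≠ 0 ∧ m j ≠ 0

variable {G : SimpleGraph (Fin n)}

/-- If x_i still divides a monomial after division by x_i, its support has not changed, and
membership in a squarefree ideal depends only on the support. -/
theorem up_down_down_mem_null (hE : EdgeRelations q G) {c : Chain K n} (hc : c ∈ null q)
    (i : Fin n) : up i (down i (down i c)) ∈ null q := by
  intro m hm
  rw [up_down_apply]
  split_ifs with h
  · rfl
  · rw [down_apply]
    refine hc _ fun h0 => hm ((hE m).2 ?_)
    obtain ⟨a, b, hab, ha, hb⟩ := (hE _).1 h0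
    refine ⟨a, b, hab, fun h' => ?_, fun h' => ?_⟩
    · have : i ≠ a := by rintro rfl; exact h h'
      simp [h', this] at ha
    · have : i ≠ b := by rintro rfl; exact h h'
      simp [h', this] at hb

/-- An edge dividing x_v x^m but not x^m contains v, and its other endpoint is a neighbour of v,
which by `hv` divides no monomial of c. -/
theorem down_mem_null (hE : EdgeRelations q G) {c : Chain K n} (hc : c ∈ null q) {v : Fin n}
    (hv : ∀ j, G.Adj v j → down j c = 0) : down v c ∈ null q := by
  intro m hm
  rw [down_apply]
  by_cases h : mono q (m + single v 1) = 0
  · obtain ⟨a, b, hab, ha, hb⟩ := (hE _).1 h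
    by_cases hav : v = a
    · subst hav
      exact apply_eq_zero_of_down_eq_zero (hv b hab) hb
    by_cases hbv : v = b
    · subst hbv
      exact apply_eq_zero_of_down_eq_zero (hv a hab.symm) ha
    refine absurd ((hE m).2 ⟨a, b, hab, ?_, ?_⟩) hm
    · simpa [hav] using ha
    · simpa [hbv] using hb
  · exact hc _ h

theorem up_up_mem_null (hE : EdgeRelations q G) {u w : Fin n} (h : G.Adj w u) (c : Chain K n) :
    up w (up u c) ∈ null q := by
  intro m hm
  rw [up_apply]
  split_ifs with h1
  · rfl
  · rw [up_apply]
    split_ifs with h2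
    · rfl
    · refine absurd ((hE m).2 ⟨w, u, h, h1, fun h3 => h2 ?_⟩) hm
      simp [h3]

/-- The homotopy formula has no `proj0` term in degree 1, and its remaining term e_v · (dc divided
by x_v) stays in the ideal since no neighbour of v occurs. So a cycle with v isolated in its support
is a boundary. -/
theorem sub_diff_htpy_mem_null (hE : EdgeRelations q G) {c : Chain K n} (hc : diff c ∈ null q)
    {v : Fin n} (hcv : proj1 v c = c) (hv : ∀ j, G.Adj v j → proj0 j c = c) :
    c - diff (htpy v c) ∈ null q := by
  have h := diff_htpy_add v c
  rw [← hcv, proj0_proj1, hcv, sub_zero] at h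
  nth_rw 1 [← h]
  rw [add_sub_cancel_left, htpy_apply]
  refine ext_mem_null (down_mem_null hE hc fun j hj => ?_) v
  rw [← hv j hj, diff_proj0, down_proj0]

/-! ### Squarefree degrees and the reduction at a leaf -/

/-- The chain `c` is homogeneous of the squarefree degree given by `S`. -/
def HasDegree (S : Finset (Fin n)) (c : Chain K n) : Prop :=
  ∀ j, (j ∈ S → proj1 j c = c) ∧ (j ∉ S → proj0 j c = c)

theorem HasDegree.down_eq_zero {S : Finset (Fin n)} {c : Chain K n} (h : HasDegree S c) {j : Fin n}
    (hj : j ∉ S) : down j c = 0 := by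
  rw [← (h j).2 hj, down_proj0]

theorem HasDegree.diff {S : Finset (Fin n)} {c : Chain K n} (h : HasDegree S c) :
    HasDegree S (diff c) :=
  fun j => ⟨fun hj => by rw [← diff_proj1, (h j).1 hj], fun hj => by rw [← diff_proj0, (h j).2 hj]⟩

theorem eq_up_down_add_ext_contr {w : Fin n} {c : Chain K n} (h : proj1 w c = c) :
    c = up w (down w c) + ext w (contr w c) := by
  rw [← h]
  simp only [proj1_apply, map_sub, map_add, down_up_self, ext_up, ext_down, contr_down, contr_up,
    contr_ext_self, contr_contr_self, map_zero]
  abel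

theorem HasDegree.contr {S : Finset (Fin n)} {c : Chain K n} (h : HasDegree S c) {w : Fin n}
    (hw : w ∈ S) : HasDegree (S.erase w) (contr w c) := by
  intro j
  by_cases hj : j = w
  · subst hj
    exact ⟨fun h' => absurd h' (Finset.notMem_erase _ _),
      fun _ => by rw [proj0_contr, (h j).1 hw]⟩
  · rw [Finset.mem_erase, and_iff_right hj]
    exact ⟨fun h' => by rw [commute_proj1 (contr_mem_evenCommutant (Ne.symm hj)), (h j).1 h'],
      fun h' => by rw [commute_proj0 (contr_mem_evenCommutant (Ne.symm hj)), (h j).2 h']⟩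

theorem HasDegree.down {S : Finset (Fin n)} {c : Chain K n} (h : HasDegree S c) {w : Fin n}
    (hw : w ∈ S) : HasDegree (S.erase w) (down w c) := by
  intro j
  by_cases hj : j = w
  · subst hj
    exact ⟨fun h' => absurd h' (Finset.notMem_erase _ _),
      fun _ => by rw [proj0_down, (h j).1 hw]⟩
  · rw [Finset.mem_erase, and_iff_right hj]
    exact ⟨fun h' => by rw [commute_proj1 (down_mem_evenCommutant (Ne.symm hj)), (h j).1 h'],
      fun h' => by rw [commute_proj0 (down_mem_evenCommutant (Ne.symm hj)), (h j).2 h']⟩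

theorem HasDegree.htpy {S : Finset (Fin n)} {c : Chain K n} (h : HasDegree S c) {v : Fin n}
    (hv : v ∈ S) : HasDegree S (htpy v c) := by
  intro j
  rw [htpy_apply]
  by_cases hj : j = v
  · subst hj
    exact ⟨fun h' => by rw [proj1_ext, proj0_down, (h j).1 hv], fun h' => absurd hv h'⟩
  · exact ⟨fun h' => by rw [commute_proj1 (ext_mem_evenCommutant (Ne.symm hj)),
        commute_proj1 (down_mem_evenCommutant (Ne.symm hj)), (h j).1 h'],
      fun h' => by rw [commute_proj0 (ext_mem_evenCommutant (Ne.symm hj)),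
        commute_proj0 (down_mem_evenCommutant (Ne.symm hj)), (h j).2 h']⟩

theorem HasDegree.add {S : Finset (Fin n)} {c c' : Chain K n} (h : HasDegree S c)
    (h' : HasDegree S c') : HasDegree S (c + c') :=
  fun j => ⟨fun hj => by rw [map_add, (h j).1 hj, (h' j).1 hj],
    fun hj => by rw [map_add, (h j).2 hj, (h' j).2 hj]⟩

/-- A squarefree cycle whose support has the leaf `v` with neighbour `w` is, up to a boundary,
divisible by `x_w`. -/
theorem exists_up_of_leaf (hE : EdgeRelations q G) {S : Finset (Fin n)} {c : Chain K n}
    (hS : HasDegree S c) (hc : diff c ∈ null q) {v w : Fin n} (hv : v ∈ S) (hw : w ∈ S) (hvw : G.Adj v w)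
    (hleaf : ∀ a ∈ S, G.Adj v a → a = w) :
    ∃ a b, HasDegree (S.erase w) a ∧ up w (diff a) ∈ null q ∧ c + diff b - up w a ∈ null q := by
  have hv' : v ∈ S.erase w := Finset.mem_erase.2 ⟨hvw.ne, hv⟩
  have hβ := hS.contr hw
  have hdβ : diff (contr w c) ∈ null q := by
    rw [← neg_neg (diff (contr w c)), ← contr_diff]
    exact neg_mem (contr_mem_null hc w)
  -- Contraction with e_w removes w from the support, and with it the only neighbour of v.
  have h1 := sub_diff_htpy_mem_null hE hdβ ((hβ v).1 hv') fun j hj => (hβ j).2 fun h =>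
    (Finset.mem_erase.1 h).1 (hleaf j (Finset.mem_erase.1 h).2 hj)
  -- With h the homotopy term, d(e_w h) = x_w h - e_w dh exchanges the e_w-part of c for x_w h.
  have h2 : c + diff (ext w (htpy v (contr w c))) - up w (down w c + htpy v (contr w c)) =
      ext w (contr w c - diff (htpy v (contr w c))) := by
    nth_rw 1 [eq_up_down_add_ext_contr ((hS w).1 hw)]
    rw [diff_ext, map_sub, map_add]
    abel
  have h3 := ext_mem_null h1 w
  rw [← h2] at h3
  refine ⟨_, _, (hS.down hw).add (hβ.htpy hv'), ?_, h3⟩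
  have h4 := diff_mem_null h3
  rw [map_sub, map_add, diff_diff, add_zero] at h4
  rw [← diff_up]
  exact (Submodule.sub_mem_iff_right _ hc).1 h4

/-- Splitting off neighbours of `w`. -/
theorem exists_realize_up_eq (hE : EdgeRelations q G) {w : Fin n} (l : List (Fin n)) (hl : l.Nodup)
    (hadj : ∀ u ∈ l, G.Adj w u) {S : Finset (Fin n)} (hlS : ∀ u ∈ l, u ∈ S) {c : Chain K n}
    (hS : HasDegree S c) (hc : up w (diff c) ∈ null q) :
    ∃ c', HasDegree (S \ l.toFinset) c' ∧ up w (diff c') ∈ null q ∧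
      realize q (up w c) = xs q w •
        ((l.map fun u => ExteriorAlgebra.ι A (Pi.single u 1 : Fin n → A)).prod *
          realize q c') := by
  induction l generalizing S c with
  | nil =>
    exact ⟨c, by simpa using hS, hc, by rw [realize_up, List.map_nil, List.prod_nil, one_mul]⟩
  | cons u l ih =>
    rw [List.nodup_cons] at hl
    have hu : u ∈ S := hlS u List.mem_cons_self
    obtain ⟨c', h1, h2, h3⟩ := ih hl.2 (fun x hx => hadj x (List.mem_cons_of_mem _ hx))
      (fun x hx => Finset.mem_erase.2 ⟨by rintro rfl; exact hl.1 hx,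
        hlS x (List.mem_cons_of_mem _ hx)⟩)
      (hS.contr hu) (by
        rw [← neg_neg (diff (contr u c)), ← contr_diff, map_neg, ← contr_up]
        exact neg_mem (contr_mem_null hc u))
    refine ⟨c', ?_, h2, ?_⟩
    · rwa [List.toFinset_cons, Finset.sdiff_insert, ← Finset.erase_sdiff_comm]
    -- Of the two parts of c in the variable u, the one divisible by x_u dies because x_w x_u is a
    -- relation.
    · nth_rw 1 [eq_up_down_add_ext_contr ((hS u).1 hu)]
      rw [map_add, map_add,
        realize_eq_zero_of_mem_null q (up_up_mem_null hE (hadj u List.mem_cons_self) _), zero_add,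
        ← ext_up, realize_ext, h3, List.map_cons, List.prod_cons, mul_smul_comm, mul_assoc]

theorem wedge_eq_prod (L : Finset (Fin n)) :
    wedge A L = ((L.sort (· ≤ ·)).map
      fun u => ExteriorAlgebra.ι A (Pi.single u 1 : Fin n → A)).prod := by
  rw [wedge, ExteriorAlgebra.ιMulti_apply]
  congr 1
  refine List.ext_getElem (by simp) fun k h1 h2 => ?_
  simp [Finset.orderEmbOfFin_apply]

/-! ### Generation by linear cycles and boundaries -/

section Generation

variable {T : Subalgebra K (ExteriorAlgebra A (Fin n → A))}

theorem realize_mem_of_hasDegree (hE : EdgeRelations q G) (hTd : ∀ z, d (xs q) z ∈ T)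
    (hTw : ∀ w L, (∀ u ∈ L, G.Adj w u) → xs q w • wedge A L ∈ T)
    (hG : ∀ S : Finset (Fin n), S.Nonempty →
      ∃ v ∈ S, ∀ a ∈ S, ∀ b ∈ S, G.Adj v a → G.Adj v b → a = b)
    {S : Finset (Fin n)} {c : Chain K n} (hS : HasDegree S c)
    (hc : diff c ∈ null q) : realize q c ∈ T := by
  classical
  induction S using Finset.strongInduction generalizing c with
  | H S ih =>
  rcases S.eq_empty_or_nonempty with rfl | hne
  · have h0 : c = single 0 (c 0) := by
      ext m
      by_cases hm : m = 0
      · subst hm; simp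
      · obtain ⟨i, hi⟩ := DFunLike.ne_iff.1 hm
        rw [Finsupp.single_eq_of_ne hm]
        exact apply_eq_zero_of_down_eq_zero (hS.down_eq_zero (Finset.notMem_empty i)) hi
    obtain ⟨r, hr⟩ := exists_algebraMap_of_contractLeft_eq_zero (b := c 0) fun i => by
      rw [← contr_apply, ← (hS i).2 (Finset.notMem_empty i), contr_proj0, Finsupp.zero_apply]
    rw [h0, realize_single, ← hr, AlgHom.commutes, mono, MvPolynomial.monomial_zero', map_one,
      map_one, one_smul]
    exact T.algebraMap_mem r
  · obtain ⟨v, hv, huniq⟩ := hG S hne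
    by_cases hiso : ∃ w ∈ S, G.Adj v w
    · obtain ⟨w, hw, hvw⟩ := hiso
      obtain ⟨a, b, ha, hda, hab⟩ := exists_up_of_leaf hE hS hc hv hw hvw
        fun u hu hvu => huniq u hu w hw hvu hvw
      have h1 := realize_eq_zero_of_mem_null q hab
      rw [map_sub, map_add, sub_eq_zero, ← d_realize] at h1
      rw [← add_sub_cancel_right (realize q c) (d (xs q) (realize q b)), h1]
      refine sub_mem ?_ (hTd _)
      -- All remaining neighbours of w are split off, so that none is left in a' when x_w is
      -- cancelled below.
      set U := (S.erase w).filter (G.Adj w) with hU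
      obtain ⟨a', ha', hda', he⟩ := exists_realize_up_eq hE (U.sort (· ≤ ·)) (Finset.sort_nodup _ _)
        (fun u hu => (Finset.mem_filter.1 ((Finset.mem_sort _).1 hu)).2)
        (fun u hu => (Finset.mem_filter.1 ((Finset.mem_sort _).1 hu)).1) ha hda
      rw [he, ← wedge_eq_prod, ← smul_mul_assoc]
      refine mul_mem (hTw w U fun u hu => (Finset.mem_filter.1 hu).2)
        (ih _ (Finset.ssubset_of_subset_of_ssubset Finset.sdiff_subset (Finset.erase_ssubset hw))
          ha' ?_)
      -- Cancel x_w: dividing x_w da' by x_w stays in the ideal, since no neighbour of w occurs.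
      rw [← down_up_self w (diff a')]
      refine down_mem_null hE hda' fun j hj => ?_
      rw [down_up_of_ne hj.ne', ha'.diff.down_eq_zero, map_zero]
      rw [Finset.sort_toFinset, Finset.mem_sdiff, hU, Finset.mem_filter]
      exact fun h => h.2 ⟨h.1, hj⟩
    · have h := sub_diff_htpy_mem_null hE hc ((hS v).1 hv) fun j hj =>
        (hS j).2 fun hjS => hiso ⟨j, hjS, hj⟩
      have h := realize_eq_zero_of_mem_null q h
      rw [map_sub, sub_eq_zero, ← d_realize] at h
      rw [h]
      exact hTd _

/-- The variables are treated one at a time. Modulo a boundary and `null`, a cycle is the sum of its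
parts of degree 0 and 1 in the i-th variable, both again cycles. -/
theorem realize_mem (hE : EdgeRelations q G) (hTd : ∀ z, d (xs q) z ∈ T)
    (hTw : ∀ w L, (∀ u ∈ L, G.Adj w u) → xs q w • wedge A L ∈ T)
    (hG : ∀ S : Finset (Fin n), S.Nonempty →
      ∃ v ∈ S, ∀ a ∈ S, ∀ b ∈ S, G.Adj v a → G.Adj v b → a = b)
    {c : Chain K n} (hc : diff c ∈ null q) : realize q c ∈ T := by
  -- M holds the variables not yet treated, and S those among the treated ones that have degree 1.
  -- At the start M is everything, so S is arbitrary.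
  suffices H : ∀ (M S : Finset (Fin n)) (c : Chain K n), diff c ∈ null q →
      (∀ j ∉ M, (j ∈ S → proj1 j c = c) ∧ (j ∉ S → proj0 j c = c)) → realize q c ∈ T from
    H Finset.univ ∅ c hc fun j hj => absurd (Finset.mem_univ j) hj
  clear hc c
  intro M
  induction M using Finset.induction_on with
  | empty =>
    exact fun S c hc h => realize_mem_of_hasDegree hE hTd hTw hG
      (fun j => h j (Finset.notMem_empty j)) hc
  | insert i M hi ih =>
    intro S c hc h
    have heven {j : Fin n} (hj : j ≠ i) : (proj0 i : Module.End K (Chain K n)) ∈ evenCommutant j ∧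
        (proj1 i : Module.End K (Chain K n)) ∈ evenCommutant j := by
      have hu := up_mem_evenCommutant (K := K) hj.symm
      have hd := down_mem_evenCommutant (K := K) hj.symm
      have he := ext_mem_evenCommutant (K := K) hj.symm
      have hk := contr_mem_evenCommutant (K := K) hj.symm
      have hud := mul_mem hu hd
      have h1 := sub_mem_evenCommutant (one_mem _) hud
      exact ⟨mul_mem h1 (mul_mem hk he), add_mem (mul_mem (sub_mem_evenCommutant hud
        (mul_mem (mul_mem hu hu) (mul_mem hd hd))) (mul_mem hk he)) (mul_mem h1 (mul_mem he hk))⟩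
    have hd0 : diff (proj0 i c) ∈ null q := by
      rw [diff_proj0]
      exact proj0_mem_null hc i
    -- As dc vanishes only modulo the ideal, the homotopy formula keeps this term; squarefreeness
    -- makes it negligible.
    have hN : up i (down i (htpy i (diff c))) ∈ null q := by
      rw [htpy_apply, ← ext_down, ← ext_up]
      exact ext_mem_null (up_down_down_mem_null hE hc i) i
    have hsum := diff_up_down_htpy_add i c
    have hd1 : diff (proj1 i c) ∈ null q := by
      have := congrArg diff hsum
      rw [map_add, diff_diff, zero_add, map_sub, map_sub] at this
      have h' := sub_mem (sub_mem hc hd0) (diff_mem_null hN)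
      rwa [this, sub_sub_cancel] at h'
    have h0 : realize q (proj0 i c) ∈ T := by
      refine ih (S.erase i) _ hd0 fun j hj => ?_
      by_cases hji : j = i
      · subst hji
        exact ⟨fun h' => absurd h' (Finset.notMem_erase _ _), fun _ => proj0_proj0 _ _⟩
      · have := h j (by simp [hji, hj])
        rw [Finset.mem_erase, and_iff_right hji]
        exact ⟨fun h' => by rw [commute_proj1 (heven hji).1, this.1 h'],
          fun h' => by rw [commute_proj0 (heven hji).1, this.2 h']⟩
    have h1 : realize q (proj1 i c) ∈ T := by
      refine ih (insert i S) _ hd1 fun j hj => ?_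
      by_cases hji : j = i
      · subst hji
        exact ⟨fun _ => proj1_proj1 _ _, fun h' => absurd (Finset.mem_insert_self _ _) h'⟩
      · have := h j (by simp [hji, hj])
        rw [Finset.mem_insert, or_iff_right hji]
        exact ⟨fun h' => by rw [commute_proj1 (heven hji).2, this.1 h'],
          fun h' => by rw [commute_proj0 (heven hji).2, this.2 h']⟩
    have h2 := congrArg (realize q) hsum
    rw [map_add, realize_eq_zero_of_mem_null q hN, add_zero, ← d_realize, map_sub, map_sub] at h2
    have h3 := add_mem (add_mem (hTd (realize q (up i (down i (htpy i c))))) h1) h0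
    rwa [h2, sub_add_cancel, sub_add_cancel] at h3

theorem mem_of_d_eq_zero (hE : EdgeRelations q G) (hTd : ∀ z, d (xs q) z ∈ T)
    (hTw : ∀ w L, (∀ u ∈ L, G.Adj w u) → xs q w • wedge A L ∈ T)
    (hG : ∀ S : Finset (Fin n), S.Nonempty →
      ∃ v ∈ S, ∀ a ∈ S, ∀ b ∈ S, G.Adj v a → G.Adj v b → a = b)
    (hqs : Function.Surjective q)
    (hq : ∀ p, q p = 0 → ∀ m ∈ p.support, mono q m = 0)
    {z : ExteriorAlgebra A (Fin n → A)} (hz : d (xs q) z = 0) : z ∈ T := by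
  obtain ⟨c, rfl⟩ := realize_surjective q hqs z
  rw [d_realize] at hz
  exact realize_mem hE hTd hTw hG (mem_null_of_realize_eq_zero q hq hz)

end Generation

end

end Koszul.Model

/-! ### Monomials in the facet ideal -/

namespace PreAbstractSimplicialComplex

open Finsupp

/-- The exponent of the squarefree monomial with support `F`. -/
noncomputable def exponent {V : Type*} (F : Finset V) : V →₀ ℕ := ∑ v ∈ F, single v 1

theorem exponent_apply {V : Type*} [DecidableEq V] (F : Finset V) (v : V) :
    exponent F v = if v ∈ F then 1 else 0 := by
  simp [exponent, Finsupp.finsetSum_apply, Finsupp.single_apply]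

theorem exponent_le_iff {V : Type*} {F : Finset V} {m : V →₀ ℕ} :
    exponent F ≤ m ↔ ∀ v ∈ F, m v ≠ 0 := by
  classical
  refine ⟨fun h v hv h0 => ?_, fun h v => ?_⟩
  · have := h v
    rw [exponent_apply, if_pos hv] at this
    omega
  · rw [exponent_apply]
    split_ifs with hv
    · exact Nat.one_le_iff_ne_zero.2 (h v hv)
    · exact Nat.zero_le _

theorem degree_exponent {V : Type*} (F : Finset V) : (exponent F).degree = F.card := by
  simp [exponent, map_sum, Finsupp.degree_single]

theorem mem_facetIdeal_iff {V K : Type*} [Field K] {Δ : PreAbstractSimplicialComplex V}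
    {p : MvPolynomial V K} :
    p ∈ Δ.facetIdeal K ↔ ∀ m ∈ p.support, ∃ F ∈ Δ.facets, exponent F ≤ m := by
  have : Δ.facetIdeal K =
      Ideal.span ((fun s => MvPolynomial.monomial s (1 : K)) '' (exponent '' Δ.facets)) := by
    rw [facetIdeal]
    congr 1
    ext f
    simp only [Set.mem_ofPred_eq, Set.mem_image, exists_exists_and_eq_and, exponent,
      MvPolynomial.monomial_sum_one]
    simp only [MvPolynomial.X, eq_comm]
  rw [this, MvPolynomial.mem_ideal_span_monomial_image]
  simp

theorem monomial_mem_facetIdeal_iff {V K : Type*} [Field K] {Δ : PreAbstractSimplicialComplex V}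
    {m : V →₀ ℕ} :
    MvPolynomial.monomial m (1 : K) ∈ Δ.facetIdeal K ↔ ∃ F ∈ Δ.facets, exponent F ≤ m := by
  classical
  rw [mem_facetIdeal_iff, MvPolynomial.support_monomial, if_neg one_ne_zero]
  simp

/-- Each monomial of the ideal is divisible by an edge monomial, and edge monomials are minimal
because one edge cannot properly contain another. So δ = 2. -/
theorem isLeast_degree_minimalGenerators {K : Type*} [Field K] {n : ℕ}
    {Δ : PreAbstractSimplicialComplex (Fin n)} (hcard : ∀ F ∈ Δ.facets, F.card = 2)
    (hne : Δ.facets.Nonempty) :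
    IsLeast (Finsupp.degree '' Koszul.minimalGenerators (Δ.facetIdeal K)) 2 := by
  have hdeg {m : Fin n →₀ ℕ} (hm : MvPolynomial.monomial m (1 : K) ∈ Δ.facetIdeal K) :
      2 ≤ m.degree := by
    obtain ⟨F, hF, h⟩ := monomial_mem_facetIdeal_iff.1 hm
    rw [← hcard F hF, ← degree_exponent]
    exact Finsupp.degree_mono h
  constructor
  · obtain ⟨F, hF⟩ := hne
    refine ⟨exponent F, ⟨monomial_mem_facetIdeal_iff.2 ⟨F, hF, le_rfl⟩, fun b hb hbF => ?_⟩, ?_⟩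
    · obtain ⟨F', hF', h⟩ := monomial_mem_facetIdeal_iff.1 hb
      have hsub : F' ⊆ F := fun v hv => by
        have := exponent_le_iff.1 (h.trans hbF) v hv
        rw [exponent_apply] at this
        by_contra hvF
        exact this (if_neg hvF)
      rw [← Finset.eq_of_subset_of_card_le hsub (by rw [hcard F hF, hcard F' hF'])]
      exact h
    · rw [degree_exponent, hcard F hF]
  · rintro _ ⟨m, hm, rfl⟩
    have hm : Minimal (fun b => MvPolynomial.monomial b (1 : K) ∈ Δ.facetIdeal K) m := hm
    exact hdeg hm.prop

theorem edgeRelations_mkₐ {K : Type*} [Field K] {n : ℕ}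
    {Δ : PreAbstractSimplicialComplex (Fin n)} (hcard : ∀ F ∈ Δ.facets, F.card = 2) :
    Koszul.Model.EdgeRelations (Ideal.Quotient.mkₐ K (Δ.facetIdeal K)) Δ.edgeGraph := by
  intro m
  rw [Koszul.Model.mono, Ideal.Quotient.mkₐ_eq_mk, Ideal.Quotient.eq_zero_iff_mem,
    monomial_mem_facetIdeal_iff]
  constructor
  · rintro ⟨F, hF, h⟩
    obtain ⟨i, j, hij, rfl⟩ := Finset.card_eq_two.1 (hcard F hF)
    rw [exponent_le_iff] at h
    exact ⟨i, j, ⟨hij, hF⟩, h i (by simp), h j (by simp)⟩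
  · rintro ⟨i, j, h, hi, hj⟩
    refine ⟨_, h.2, exponent_le_iff.2 fun v hv => ?_⟩
    rcases Finset.mem_insert.1 hv with rfl | hv
    · exact hi
    · rwa [Finset.mem_singleton.1 hv]

end PreAbstractSimplicialComplex

/-! ### Linear cycles and the homology algebra -/

namespace Koszul

/-- Every term of the differential of the product carries some x_u, which x_w annihilates. -/
theorem smul_d_prod_eq_zero {A : Type*} [CommRing A] {n : ℕ} (x : Fin n → A) (w : Fin n)
    (l : List (Fin n)) (hl : ∀ u ∈ l, x w * x u = 0) :
    x w • d x ((l.map fun u => ExteriorAlgebra.ι A (Pi.single u 1 : Fin n → A)).prod) = 0 := by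
  induction l with
  | nil => rw [List.map_nil, List.prod_nil, d_one, smul_zero]
  | cons u l ih =>
    rw [List.map_cons, List.prod_cons, d_ι_mul, Fintype.linearCombination_apply_single, one_smul,
      smul_sub, smul_smul, hl u List.mem_cons_self, zero_smul, ← mul_smul_comm,
      ih fun v hv => hl v (List.mem_cons_of_mem _ hv), mul_zero, sub_zero]

theorem d_smul_wedge_eq_zero {A : Type*} [CommRing A] {n : ℕ} (x : Fin n → A) (w : Fin n)
    (L : Finset (Fin n)) (hL : ∀ u ∈ L, x w * x u = 0) : d x (x w • wedge A L) = 0 := by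
  rw [Model.wedge_eq_prod, map_smul]
  exact smul_d_prod_eq_zero x w _ fun u hu => hL u ((Finset.mem_sort _).1 hu)

namespace Model

variable {K A : Type*} [Field K] [CommRing A] [Algebra K A] {n : ℕ}
  {q : MvPolynomial (Fin n) K →ₐ[K] A} {G : SimpleGraph (Fin n)}

theorem adjoin_homology_eq_top (hE : EdgeRelations q G)
    (hG : ∀ S : Finset (Fin n), S.Nonempty →
      ∃ v ∈ S, ∀ a ∈ S, ∀ b ∈ S, G.Adj v a → G.Adj v b → a = b)
    (hqs : Function.Surjective q) (hq : ∀ p, q p = 0 → ∀ m ∈ p.support, mono q m = 0)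
    {L : Set (cycles (xs q))} (hL : ∀ (z : cycles (xs q)) (w : Fin n) (U : Finset (Fin n)),
      (z : ExteriorAlgebra A (Fin n → A)) = xs q w • wedge A U → z ∈ L) :
    Algebra.adjoin K (Ideal.Quotient.mk (boundaries (xs q)) '' L) = ⊤ := by
  let π : cycles (xs q) →ₐ[K] Homology (xs q) := Ideal.Quotient.mkₐ K (boundaries (xs q))
  set B := Algebra.adjoin K (Ideal.Quotient.mk (boundaries (xs q)) '' L) with hB
  -- The cycles whose class lies in B. Boundaries belong to T, having class 0, so it suffices to
  -- generate all cycles up to boundaries.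
  let T : Subalgebra K (ExteriorAlgebra A (Fin n → A)) :=
    (B.comap π).map ((cycles (xs q)).val.restrictScalars K)
  have hTd : ∀ z, d (xs q) z ∈ T := by
    intro z
    refine ⟨⟨d (xs q) z, d_d _ z⟩, ?_, rfl⟩
    have h0 : π ⟨d (xs q) z, d_d _ z⟩ = 0 := Ideal.Quotient.eq_zero_iff_mem.2 ⟨z, rfl⟩
    change π _ ∈ B
    rw [h0]
    exact zero_mem B
  have hTw : ∀ w U, (∀ u ∈ U, G.Adj w u) → xs q w • wedge A U ∈ T := by
    intro w U hU
    have hz : d (xs q) (xs q w • wedge A U) = 0 := by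
      refine d_smul_wedge_eq_zero _ w U fun u hu => ?_
      have h := (hE (Finsupp.single u 1 + Finsupp.single w 1)).2
        ⟨w, u, hU u hu, by simp, by simp⟩
      rw [mono_add_single] at h
      exact h
    exact ⟨⟨_, hz⟩, Algebra.subset_adjoin ⟨_, hL _ w U rfl, rfl⟩, rfl⟩
  refine eq_top_iff.2 fun h _ => ?_
  obtain ⟨z, rfl⟩ := Ideal.Quotient.mk_surjective h
  obtain ⟨z', hz', hzz'⟩ := mem_of_d_eq_zero hE hTd hTw hG hqs hq z.2
  obtain rfl : z' = z := Subtype.ext hzz'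
  exact hz'

end Model

end Koszul

theorem proposition2p12 (K : Type*) [Field K] (n : ℕ) (Δ : PreAbstractSimplicialComplex (Fin n))
    (hforest : Δ.IsForest) (hdim : Δ.HasDimension 1) (hpure : Δ.IsPure) :
    Algebra.adjoin K
      ((Ideal.Quotient.mk (Koszul.boundaries (Koszul.vars (Δ.facetIdeal K)))) ''
        Koszul.linearMonomialCycles (Δ.facetIdeal K)) =
      (⊤ : Subalgebra K (Koszul.Homology (Koszul.vars (Δ.facetIdeal K)))) := by
  have hcard : ∀ F ∈ Δ.facets, F.card = 2 := fun F hF =>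
    PreAbstractSimplicialComplex.card_eq_two_of_mem_facets hdim hpure hF
  have hne : Δ.facets.Nonempty := by
    obtain ⟨⟨E, hE, -⟩, -⟩ := hdim
    exact (Δ.exists_facet_superset hE).imp fun _ h => h.1
  refine Koszul.Model.adjoin_homology_eq_top (q := Ideal.Quotient.mkₐ K (Δ.facetIdeal K))
    (PreAbstractSimplicialComplex.edgeRelations_mkₐ hcard)
    (fun S hS => hforest.exists_vertex hcard hS) (Ideal.Quotient.mkₐ_surjective K _)
    (fun p hp m hm => ?_) (fun z w U hz => ?_)
  · rw [Ideal.Quotient.mkₐ_eq_mk, Ideal.Quotient.eq_zero_iff_mem,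
      PreAbstractSimplicialComplex.mem_facetIdeal_iff] at hp
    exact Ideal.Quotient.eq_zero_iff_mem.2
      (PreAbstractSimplicialComplex.monomial_mem_facetIdeal_iff.2 (hp m hm))
  -- The monomial f is x_w, of degree 1 = δ - 1.
  · refine ⟨Finsupp.single w 1, U, ?_, hz⟩
    rw [Finsupp.degree_single]
    exact PreAbstractSimplicialComplex.isLeast_degree_minimalGenerators hcard hne
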